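/- Conventions. Semigroups are non-empty. A pseudovariety $\mathsf V$ is a class of finite semigroups closed under subsemigroups, homomorphic images and finite direct products; $\mathsf S$, $\mathsf G_p$ ($p$ prime) and $\mathsf G_{nil}$ are the pseudovarieties of all finite semigroups, all finite $p$-groups and all finite nilpotent groups. For a finite set $A$, $\overline\Omega_A\mathsf V$ is the free pro-$\mathsf V$ semigroup on $A$ (equivalently, the topological semigroup of all $A$-ary implicit operations on $\mathsf V$), and $\psi_{\mathsf V}:\overline\Omega_A\mathsf S\to\overline\Omega_A\mathsf V$ is the canonical projection; $\mathsf V$ satisfies $u=v$ if $\psi_{\mathsf V}(u)=\psi_{\mathsf V}(v)$. An implicit signature $\tau$ is a set of pseudowords (elements of the $\overline\Omega_{n}\mathsf S$) containing multiplication, and $\Omega^\tau_A\mathsf V$ is the $\tau$-subalgebra of $\overline\Omega_A\mathsf V$ generated by $A$. The signature $\kappa$ consists of multiplication and $x\mapsto x^{\omega-1}=\lim_k x^{k!-1}$. The signature $\sigma$ consists of $\kappa$ together with all implicit operations $$\bigl(a_j\circ(w_1,\dots,w_n)^{\omega}\bigr)^{m^\omega}\qquad(n\ge 1,\ 1\le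 j\le n,\ m\ge 1),$$ where $w_1,\dots,w_n$ are $\kappa$-terms in the letters $a_1,\dots,a_n$ whose matrix $M(w_1,\dots,w_n)$ of exponent sums (with $(i,j)$ entry the sum of the exponents of $a_j$ in $w_i$, reading $x^{\omega-1}$ as $x^{-1}$) has non-zero determinant, and every prime dividing $\det M(w_1,\dots,w_n)$ divides $m$. Here $a_j\circ(w_1,\dots,w_n)^\omega$ is the $j$-th component of $\lim_k (w_1,\dots,w_n)^{k!}$, the powers being compositions of the operator $(s_1,\dots,s_n)\mapsto(w_i(s_1,\dots,s_n))_i$, and $x^{m^\omega}=\lim_k x^{m^{k!}}$. A system over a finite alphabet $A$ consists of disjoint finite sets $X$ (variables) and $P$ (parameters), finitely many equations $u_i=v_i$ with $u_i,v_i\in\overline\Omega_{X\cup P}\mathsf S$, rational languages $L_x\subseteq A^*$ ($x\in X$) and elements $w_p\in\overline\Omega_A\mathsf S$ ($p\in P$). A solution modulo $\mathsf V$ is a map $\delta:X\cup P\to\overline\Omega_A\mathsf S$, extended to a continuous homomorphism on $\overline\Omega_{X\cup P}\mathsf S$, such that $\delta(x)$ lies in the closure of (the non-empty words of) $L_x$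 in $\overline\Omega_A\mathsf S$ for every $x\in X$, $\delta(p)=w_p$ for every $p\in P$, and $\mathsf V$ satisfies $\delta(u_i)=\delta(v_i)$ for all $i$. The system is a system of $\tau$-terms if all $u_i,v_i\in\Omega^\tau_{X\cup P}\mathsf S$ and all $w_p\in\Omega^\tau_A\mathsf S$. $\mathsf V$ is $\tau$-reducible for such a system if, whenever the system has a solution modulo $\mathsf V$, it has one with all values in $\Omega^\tau_A\mathsf S$; $\mathsf V$ is completely $\tau$-reducible if it is $\tau$-reducible for every system of $\tau$-terms (over every finite alphabet). Corollary. The pseudovariety $\mathsf G_{nil}$ is not completely $\sigma$-reducible. Moreover, let $A=\{a,b\}$ and consider the equation $$[x^2a,\;y^{-1}z^2by]=1,\qquad [u,v]=uvu^{-1}v^{-1},$$ in the variables $x,y,z$, with the letters $a,b$ as parameters and with the constraints $x\in a^*$, $z\in b^*$, $y\in A^*$ (inverses are read as $(\omega-1)$-powers, and $1$ as $x^{\omega-1}x$). Then: 1. this is a system of $\sigma$-terms; 2. for every odd prime $p$ it has a solution modulo $\mathsf G_p$, but $\mathsf G_p$ is not $\sigma$-reducible for it; 3. the equation has no solution $x,y,z$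 in the free group on $\{a,b\}$, even without the constraints; 4. for every prime $p$, $\Omega^\sigma_A\mathsf G_p$ is the free group on $A$: there is an injective homomorphism from the free group on $A$ to $\overline\Omega_A\mathsf G_p$ which is the identity on $A$ and has image $\Omega^\sigma_A\mathsf G_p$. -/

import Mathlib

/-! # Pseudovarieties, pseudowords, implicit signatures and reducibility -/

namespace Pseudo

/-! ## Pseudovarieties of (finite, non-empty) semigroups -/

/-- A pseudovariety of semigroups: a class of finite (non-empty) semigroups closed under taking
subsemigroups, homomorphic images and finite direct products (isomorphic copies are included). -/
structure Pseudovariety where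
  Mem : ∀ (T : Type) [Semigroup T], Prop
  finite : ∀ {T : Type} [Semigroup T], Mem T → Finite T
  nonempty : ∀ {T : Type} [Semigroup T], Mem T → Nonempty T
  of_injective : ∀ {T T' : Type} [Semigroup T] [Semigroup T'] (f : T' →ₙ* T),
    Function.Injective f → Nonempty T' → Mem T → Mem T'
  of_surjective : ∀ {T T' : Type} [Semigroup T] [Semigroup T'] (f : T →ₙ* T'),
    Function.Surjective f → Mem T → Mem T'
  prod : ∀ {T T' : Type} [Semigroup T] [Semigroup T'], Mem T → Mem T' → Mem (T × T')
  unit : Mem PUnit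

/-- `𝖲`: the pseudovariety of all finite semigroups. -/
def allSemigroups : Pseudovariety where
  Mem T _ := Finite T ∧ Nonempty T
  finite h := h.1
  nonempty h := h.2
  of_injective f hf hn h := ⟨haveI := h.1; Finite.of_injective f hf, hn⟩
  of_surjective f hf h := ⟨haveI := h.1; Finite.of_surjective f hf, h.2.map f⟩
  prod h h' := ⟨haveI := h.1; haveI := h'.1; inferInstance,
    haveI := h.2; haveI := h'.2; inferInstance⟩
  unit := ⟨inferInstance, inferInstance⟩

/-- A non-empty subset of a finite group that is closed under multiplication is a subgroup. -/
def subgroupOfFinite {G : Type} [Group G] [Finite G] (K : Set G) (hn : K.Nonempty)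
    (hm : ∀ x ∈ K, ∀ y ∈ K, x * y ∈ K) : Subgroup G :=
  have hpow : ∀ x ∈ K, ∀ n : ℕ, x ^ (n + 1) ∈ K := by
    intro x hx n
    induction n with
    | zero => simpa using hx
    | succ n ih => rw [pow_succ]; exact hm _ ih _ hx
  have hone : (1 : G) ∈ K := by
    obtain ⟨x, hx⟩ := hn
    have h := hpow x hx (orderOf x - 1)
    rwa [Nat.sub_add_cancel (orderOf_pos x), pow_orderOf_eq_one] at h
  { carrier := K
    mul_mem' := fun {x y} hx hy => hm x hx y hy
    one_mem' := hone
    inv_mem' := by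
      intro x hx
      have h : x⁻¹ = x ^ (orderOf x - 1) := by
        rw [inv_eq_iff_mul_eq_one, ← pow_succ', Nat.sub_add_cancel (orderOf_pos x),
          pow_orderOf_eq_one]
      rw [h]
      rcases Nat.eq_zero_or_pos (orderOf x - 1) with h0 | h0
      · rw [h0, pow_zero]; exact hone
      · have := hpow x hx (orderOf x - 1 - 1)
        rwa [Nat.sub_add_cancel h0] at this }

/-- The pseudovariety of all finite semigroups which are groups with a given property `P`, where
`P` is a property of groups inherited by subgroups, quotients and finite direct products. -/
def ofGroups (P : ∀ (G : Type) [Group G], Prop)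
    (hsub : ∀ (G : Type) [Group G] (H : Subgroup G), P G → P H)
    (hquot : ∀ (G H : Type) [Group G] [Group H] (f : G →* H), Function.Surjective f → P G → P H)
    (hprod : ∀ (G H : Type) [Group G] [Group H], P G → P H → P (G × H))
    (hunit : P PUnit) : Pseudovariety where
  Mem T _ := Finite T ∧ ∃ (G : Type) (_ : Group G), P G ∧ Nonempty (T ≃* G)
  finite h := h.1
  nonempty := by
    rintro T _ ⟨_, G, _, _, ⟨e⟩⟩
    exact ⟨e.symm 1⟩
  of_injective := by
    rintro T T' _ _ f hf hn ⟨_, G, _, hG, ⟨e⟩⟩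
    have : Finite G := Finite.of_equiv T e.toEquiv
    let g : T' →ₙ* G := (e : T →ₙ* G).comp f
    have hg : Function.Injective g := e.injective.comp hf
    let K : Subgroup G := subgroupOfFinite (Set.range g) ⟨_, Set.mem_range_self hn.some⟩
      (by rintro _ ⟨x, rfl⟩ _ ⟨y, rfl⟩; exact ⟨x * y, map_mul g x y⟩)
    let g' : T' →ₙ* K := ⟨fun t => ⟨g t, Set.mem_range_self t⟩,
      fun x y => Subtype.ext (map_mul g x y)⟩
    refine ⟨Finite.of_injective f hf, K, inferInstance, hsub G K hG, ⟨MulEquiv.ofBijective g' ?_⟩⟩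
    refine ⟨fun x y h => hg (congrArg Subtype.val h), ?_⟩
    rintro ⟨_, ⟨t, rfl⟩⟩
    exact ⟨t, rfl⟩
  of_surjective := by
    rintro T T' _ _ f hf ⟨_, G, _, hG, ⟨e⟩⟩
    let g : G →ₙ* T' := f.comp (e.symm : G →ₙ* T)
    have hg : Function.Surjective g := hf.comp e.symm.surjective
    let c : Con G := Con.ker g
    refine ⟨Finite.of_surjective f hf, c.Quotient, inferInstance,
      hquot G c.Quotient c.mk' Con.mk'_surjective hG, ⟨MulEquiv.symm (MulEquiv.ofBijective
        (⟨fun q => Quotient.lift g (fun _ _ h => h) q, ?_⟩ : c.Quotient →ₙ* T') ⟨?_, ?_⟩)⟩⟩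
    · intro x y
      induction x, y using Con.induction_on₂ with
      | _ x y => exact map_mul g x y
    · intro x y
      induction x, y using Con.induction_on₂ with
      | _ x y => exact fun h => (Con.eq c).2 h
    · intro t
      obtain ⟨x, rfl⟩ := hg t
      exact ⟨(x : c.Quotient), rfl⟩
  prod := by
    rintro T T' _ _ ⟨_, G, _, hG, ⟨e⟩⟩ ⟨_, G', _, hG', ⟨e'⟩⟩
    refine ⟨inferInstance, G × G', Prod.instGroup, hprod G G' hG hG', ⟨?_⟩⟩
    exact MulEquiv.mk' (e.toEquiv.prodCongr e'.toEquiv)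
      (fun x y => Prod.ext (map_mul e x.1 y.1) (map_mul e' x.2 y.2))
  unit := ⟨inferInstance, PUnit, inferInstance, hunit, ⟨MulEquiv.refl _⟩⟩

/-- `𝖦_p`: the pseudovariety of all finite `p`-groups. -/
def Gp (p : ℕ) : Pseudovariety :=
  ofGroups (fun G _ => IsPGroup p G)
    (fun _ _ H h => IsPGroup.to_subgroup h H)
    (fun _ _ _ _ f hf h => h.of_surjective f hf)
    (by
      intro G H _ _ hG hH x
      obtain ⟨k, hk⟩ := hG x.1
      obtain ⟨l, hl⟩ := hH x.2
      refine ⟨k + l, Prod.ext ?_ ?_⟩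
      · simp [pow_add, pow_mul, hk]
      · simp [pow_add, pow_mul', hl])
    (fun _ => ⟨0, rfl⟩)

/-- `𝖦_nil`: the pseudovariety of all finite nilpotent groups. -/
def Gnil : Pseudovariety :=
  ofGroups (fun G _ => Group.IsNilpotent G)
    (fun _ _ _ h => haveI := h; inferInstance)
    (fun _ _ _ _ f hf h => haveI := h; Group.nilpotent_of_surjective f hf)
    (fun _ _ _ _ h h' => haveI := h; haveI := h'; inferInstance)
    inferInstance

theorem Pseudovariety.mem_all (V : Pseudovariety) {T : Type} [Semigroup T] (h : V.Mem T) :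
    allSemigroups.Mem T := ⟨V.finite h, V.nonempty h⟩

/-! ## Free pro-`V` semigroups -/

/-- `Ω̄_A V`, the free pro-`V` semigroup on `A`, realised as the semigroup of `A`-ary implicit
operations on `V`: families of operations `w_T : T ^ A → T`, for `T` in `V`, that commute with
all homomorphisms between members of `V`. -/
@[ext]
structure PW (V : Pseudovariety) (A : Type) : Type 1 where
  op : ∀ (T : Type) [Semigroup T], V.Mem T → (A → T) → T
  natural : ∀ {T T' : Type} [Semigroup T] [Semigroup T'] (h : V.Mem T) (h' : V.Mem T')
    (f : T →ₙ* T') (φ : A → T), f (op T h φ) = op T' h' (f ∘ φ)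

namespace PW

variable {V : Pseudovariety} {A : Type}

/-- Multiplication in `Ω̄_A V`. -/
instance : Semigroup (PW V A) where
  mul u v :=
    { op := fun T _ h φ => u.op T h φ * v.op T h φ
      natural := by
        intro T T' _ _ h h' f φ
        rw [map_mul, u.natural h h', v.natural h h'] }
  mul_assoc u v w := by
    ext T _ h φ
    exact mul_assoc _ _ _

theorem mul_op (u v : PW V A) (T : Type) [Semigroup T] (h : V.Mem T) (φ : A → T) :
    (u * v).op T h φ = u.op T h φ * v.op T h φ := rfl

/-- The topology of `Ω̄_A V`: the coarsest one for which all evaluations `w ↦ w_T(φ)` in the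
(discrete) members `T` of `V` are continuous. -/
instance : TopologicalSpace (PW V A) :=
  TopologicalSpace.generateFrom
    {U | ∃ (T : Type) (_ : Semigroup T) (h : V.Mem T) (φ : A → T) (t : T),
      U = {w | w.op T h φ = t}}

/-- The canonical map `A → Ω̄_A V`: a letter is the corresponding component projection. -/
def letter (V : Pseudovariety) {A : Type} (a : A) : PW V A where
  op _ _ _ φ := φ a
  natural _ _ _ _ := rfl

/-- The projection `ψ_V : Ω̄_A 𝖲 → Ω̄_A V`. -/
def psi (V : Pseudovariety) (w : PW allSemigroups A) : PW V A where
  op T _ h φ := w.op T (V.mem_all h) φ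
  natural h h' f φ := w.natural (V.mem_all h) (V.mem_all h') f φ

/-- The interpretation of a pseudoword `f ∈ Ω̄_Y 𝖲` as an operation on `Ω̄_A V`. It is also
the value `δ(f)` at `f` of the unique continuous homomorphism `Ω̄_Y 𝖲 → Ω̄_A V` extending a map
`δ : Y → Ω̄_A V`. -/
def subst {Y : Type} (f : PW allSemigroups Y) (δ : Y → PW V A) : PW V A where
  op T _ h φ := f.op T (V.mem_all h) (fun y => (δ y).op T h φ)
  natural h h' g φ := by
    rw [f.natural (V.mem_all h) (V.mem_all h')]
    congr 1
    funext y
    exact (δ y).natural h h' g φ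

/-- A sequence of pseudowords converges if its value in every finite semigroup is eventually
constant. -/
def Converges (s : ℕ → PW V A) : Prop :=
  ∀ (T : Type) [Semigroup T] (h : V.Mem T) (φ : A → T),
    ∃ t : T, ∀ᶠ k in Filter.atTop, (s k).op T h φ = t

/-- The limit of a converging sequence of pseudowords. -/
noncomputable def lim (s : ℕ → PW V A) (hs : Converges s) : PW V A where
  op T _ h φ := (hs T h φ).choose
  natural {T T'} _ _ h h' f φ := by
    obtain ⟨k, hk, hk'⟩ := ((hs T h φ).choose_spec.and (hs T' h' (f ∘ φ)).choose_spec).exists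
    rw [← hk, ← hk', (s k).natural h h']

theorem lim_op (s : ℕ → PW V A) (hs : Converges s) (T : Type) [Semigroup T] (h : V.Mem T)
    (φ : A → T) : ∀ᶠ k in Filter.atTop, (s k).op T h φ = (lim s hs).op T h φ :=
  (hs T h φ).choose_spec

theorem tendsto_lim (s : ℕ → PW V A) (hs : Converges s) :
    Filter.Tendsto s Filter.atTop (nhds (lim s hs)) := by
  rw [TopologicalSpace.tendsto_nhds_generateFrom_iff]
  rintro _ ⟨T, _, h, φ, t, rfl⟩ ht
  filter_upwards [lim_op s hs T h φ] with k hk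
  exact hk.trans ht

end PW

/-! ## Powers -/

/-- The power `s ^ k` in a semigroup, for `k ≥ 1` (and `s` itself for `k = 0`). -/
def spow {T : Type*} [Semigroup T] (s : T) (k : ℕ) : T := (fun t => t * s)^[k - 1] s

theorem coe_spow {T : Type*} [Semigroup T] (s : T) {k : ℕ} (hk : 1 ≤ k) :
    ((spow s k : T) : WithOne T) = (s : WithOne T) ^ k := by
  obtain ⟨n, rfl⟩ := Nat.exists_eq_add_of_le' hk
  induction n with
  | zero => simp [spow]
  | succ n ih =>
    have h : spow s (n + 1 + 1) = spow s (n + 1) * s := by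
      simp only [spow, Nat.add_sub_cancel, Function.iterate_succ_apply']
    rw [h, WithOne.coe_mul, ih (by omega), pow_succ _ (n + 1)]

theorem PW.spow_op {V : Pseudovariety} {A : Type} (u : PW V A) (k : ℕ) (T : Type) [Semigroup T]
    (h : V.Mem T) (φ : A → T) : (spow u k).op T h φ = spow (u.op T h φ) k := by
  unfold spow
  induction (k - 1) with
  | zero => rfl
  | succ n ih => rw [Function.iterate_succ_apply', Function.iterate_succ_apply', PW.mul_op, ih]

/-- In a finite monoid, `x ^ e k` is eventually constant if `e` tends to infinity and is
eventually constant modulo every positive integer. -/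
theorem pow_eventually_const {M : Type*} [Monoid M] [Finite M] (x : M) (e : ℕ → ℕ)
    (h1 : Filter.Tendsto e Filter.atTop Filter.atTop)
    (h2 : ∀ p : ℕ, 0 < p → ∃ c : ZMod p, ∀ᶠ k in Filter.atTop, ((e k : ℕ) : ZMod p) = c) :
    ∃ y : M, ∀ᶠ k in Filter.atTop, x ^ e k = y := by
  obtain ⟨i, j, hij, hx⟩ := Finite.exists_ne_map_eq_of_infinite (fun n : ℕ => x ^ n)
  wlog hlt : i < j generalizing i j
  · exact this j i hij.symm hx.symm (lt_of_le_of_ne (not_lt.1 hlt) hij.symm)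
  obtain ⟨p, rfl⟩ := Nat.exists_eq_add_of_lt hlt
  have hx' : x ^ i = x ^ (i + (p + 1)) := hx
  have key : ∀ a, i ≤ a → ∀ d, x ^ (a + (p + 1) * d) = x ^ a := by
    intro a ha d
    obtain ⟨b, rfl⟩ := Nat.exists_eq_add_of_le ha
    induction d with
    | zero => simp
    | succ d ih =>
      have : i + b + (p + 1) * (d + 1) = (i + (p + 1)) + (b + (p + 1) * d) := by ring
      rw [this, pow_add, ← hx', ← pow_add, ← add_assoc, ih]
  have key2 : ∀ a b, i ≤ a → i ≤ b → ((a : ℕ) : ZMod (p + 1)) = b → x ^ a = x ^ b := by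
    intro a b ha hb hab
    wlog hle : a ≤ b generalizing a b
    · exact (this b a hb ha hab.symm (not_le.1 hle).le).symm
    rw [ZMod.natCast_eq_natCast_iff] at hab
    obtain ⟨d, hd⟩ := (Nat.modEq_iff_dvd' hle).1 hab
    have : b = a + (p + 1) * d := by omega
    rw [this, key a ha]
  obtain ⟨c, hc⟩ := h2 (p + 1) (Nat.succ_pos p)
  have hE := (h1.eventually_ge_atTop i).and hc
  obtain ⟨k0, hk0⟩ := hE.exists
  refine ⟨x ^ e k0, ?_⟩
  filter_upwards [hE] with k hk
  exact key2 _ _ hk.1 hk0.1 (hk.2.trans hk0.2.symm)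

theorem tendsto_factorial : Filter.Tendsto Nat.factorial Filter.atTop Filter.atTop :=
  Filter.tendsto_atTop_mono Nat.self_le_factorial Filter.tendsto_id

theorem factorial_eventually_zero (p : ℕ) (hp : 0 < p) :
    ∀ᶠ k in Filter.atTop, ((Nat.factorial k : ℕ) : ZMod p) = 0 := by
  filter_upwards [Filter.eventually_ge_atTop p] with k hk
  exact (ZMod.natCast_eq_zero_iff _ _).2 (Nat.dvd_factorial hp hk)

theorem pow_factorial_eventually_const {M : Type*} [Monoid M] [Finite M] (x : M) :
    ∃ y : M, ∀ᶠ k in Filter.atTop, x ^ Nat.factorial k = y :=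
  pow_eventually_const x _ tendsto_factorial
    fun p hp => ⟨0, factorial_eventually_zero p hp⟩

theorem spow_eventually_const {T : Type*} [Semigroup T] [Finite T] (s : T) (e : ℕ → ℕ)
    (h1 : Filter.Tendsto e Filter.atTop Filter.atTop)
    (h2 : ∀ p : ℕ, 0 < p → ∃ c : ZMod p, ∀ᶠ k in Filter.atTop, ((e k : ℕ) : ZMod p) = c) :
    ∃ t : T, ∀ᶠ k in Filter.atTop, spow s (e k) = t := by
  have : Finite (WithOne T) := inferInstanceAs (Finite (Option T))
  obtain ⟨y, hy⟩ := pow_eventually_const (s : WithOne T) e h1 h2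
  have hE := (h1.eventually_ge_atTop 1).and hy
  obtain ⟨k0, hk0⟩ := hE.exists
  refine ⟨spow s (e k0), ?_⟩
  filter_upwards [hE] with k hk
  rw [← WithOne.coe_inj, coe_spow s hk.1, coe_spow s hk0.1, hk.2, hk0.2]

/-! ## The implicit operations `x ^ (ω - 1)`, `x ^ (m ^ ω)` and `a_j ∘ (w_1, …, w_n) ^ ω` -/

namespace PW

theorem converges_omegaInv {V : Pseudovariety} {A : Type} (u : PW V A) :
    Converges (fun k => spow u (Nat.factorial k - 1)) := by
  intro T _ h φ
  have := V.finite h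
  simp only [spow_op]
  refine spow_eventually_const _ _ ?_ ?_
  · exact (Filter.tendsto_sub_atTop_nat 1).comp tendsto_factorial
  · intro p hp
    refine ⟨-1, ?_⟩
    filter_upwards [factorial_eventually_zero p hp] with k hk
    rw [Nat.cast_sub (Nat.factorial_pos k), hk]
    simp

/-- `u ^ (ω - 1) = lim u ^ (k! - 1)`. -/
noncomputable def omegaInv {V : Pseudovariety} {A : Type} (u : PW V A) : PW V A :=
  lim _ (converges_omegaInv u)

theorem converges_powOmega {V : Pseudovariety} {A : Type} (u : PW V A) (m : ℕ) (hm : 0 < m) :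
    Converges (fun k => spow u (m ^ Nat.factorial k)) := by
  intro T _ h φ
  have := V.finite h
  simp only [spow_op]
  rcases Nat.lt_or_ge 1 m with h1 | h1
  · refine spow_eventually_const _ _ ?_ ?_
    · exact Filter.tendsto_atTop_mono (fun k => (Nat.lt_pow_self h1).le) tendsto_factorial
    · intro p hp
      have : NeZero p := ⟨hp.ne'⟩
      obtain ⟨c, hc⟩ := pow_factorial_eventually_const (m : ZMod p)
      refine ⟨c, ?_⟩
      filter_upwards [hc] with k hk
      rw [Nat.cast_pow, hk]
  · obtain rfl : m = 1 := by omega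
    exact ⟨spow (u.op T h φ) 1, by simp⟩

/-- `u ^ (m ^ ω) = lim u ^ (m ^ k!)`, for a positive integer `m`. -/
noncomputable def powOmega {V : Pseudovariety} {A : Type} (u : PW V A) (m : ℕ) (hm : 0 < m) :
    PW V A :=
  lim _ (converges_powOmega u m hm)

/-- The `k`-th power, under composition, of the implicit operator `(w_1, …, w_n)`. -/
def operatorPow {n : ℕ} (w : Fin n → PW allSemigroups (Fin n)) :
    ℕ → Fin n → PW allSemigroups (Fin n)
  | 0 => letter allSemigroups
  | k + 1 => fun i => (w i).subst (operatorPow w k)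

theorem operatorPow_op {n : ℕ} (w : Fin n → PW allSemigroups (Fin n)) (k : ℕ) (T : Type)
    [Semigroup T] (h : allSemigroups.Mem T) (φ : Fin n → T) :
    (fun i => (operatorPow w k i).op T h φ) = (fun s i => (w i).op T h s)^[k] φ := by
  induction k with
  | zero => rfl
  | succ k ih =>
    rw [Function.iterate_succ_apply', ← ih]
    rfl

theorem converges_operatorOmega {n : ℕ} (w : Fin n → PW allSemigroups (Fin n)) (j : Fin n) :
    Converges (fun k => operatorPow w (Nat.factorial k) j) := by
  intro T _ h φ
  have : Finite T := h.1
  let g : (Fin n → T) → (Fin n → T) := fun s i => (w i).op T h s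
  have : Finite (Function.End (Fin n → T)) :=
    inferInstanceAs (Finite ((Fin n → T) → (Fin n → T)))
  obtain ⟨y, hy⟩ := pow_factorial_eventually_const (M := Function.End (Fin n → T)) g
  refine ⟨(y : (Fin n → T) → (Fin n → T)) φ j, ?_⟩
  filter_upwards [hy] with k hk
  have h1 := congrFun (operatorPow_op w (Nat.factorial k) T h φ) j
  have h2 : g^[Nat.factorial k] = y := by
    rw [← hk]
    exact (hom_coe_pow (fun f : Function.End (Fin n → T) => (f : (Fin n → T) → (Fin n → T)))
      rfl (fun _ _ => rfl) g _).symm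
  rw [← h2]
  exact h1

/-- `a_j ∘ (w_1, …, w_n) ^ ω`: the `j`-th component of the `ω`-power of the operator
`(w_1, …, w_n)`, that is of the limit of its powers with exponents `k!`. -/
noncomputable def operatorOmega {n : ℕ} (w : Fin n → PW allSemigroups (Fin n)) (j : Fin n) :
    PW allSemigroups (Fin n) :=
  lim _ (converges_operatorOmega w j)

end PW

/-! ## Implicit signatures -/

/-- Multiplication as a binary pseudoword. -/
def mulOp : PW allSemigroups (Fin 2) := PW.letter _ 0 * PW.letter _ 1

/-- `x ↦ x ^ (ω - 1)` as a unary pseudoword. -/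
noncomputable def omegaInvOp : PW allSemigroups (Fin 1) := PW.omegaInv (PW.letter _ 0)

/-- An implicit signature: a set of pseudowords (with their arities) containing the
multiplication. -/
structure ImplicitSignature where
  ops : Set (Σ n : ℕ, PW allSemigroups (Fin n))
  mul_mem : ⟨2, mulOp⟩ ∈ ops

/-- The canonical signature `κ`. -/
noncomputable def kappa : ImplicitSignature where
  ops := {⟨2, mulOp⟩, ⟨1, omegaInvOp⟩}
  mul_mem := Or.inl rfl

/-- Terms over the canonical signature in the letters `a_1, …, a_n`. -/
inductive KTerm (n : ℕ) : Type
  | var (i : Fin n) : KTerm n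
  | mul (s t : KTerm n) : KTerm n
  | omegaInv (t : KTerm n) : KTerm n

/-- The pseudoword represented by a `κ`-term. -/
noncomputable def KTerm.eval {n : ℕ} : KTerm n → PW allSemigroups (Fin n)
  | var i => PW.letter _ i
  | mul s t => s.eval * t.eval
  | omegaInv t => t.eval.omegaInv

/-- The sum of the exponents of the letter `a_j` in the group word given by a `κ`-term (where
`x ^ (ω - 1)` is read as the inverse of `x`). -/
def KTerm.expSum {n : ℕ} (j : Fin n) : KTerm n → ℤ
  | var i => if i = j then 1 else 0
  | mul s t => s.expSum j + t.expSum j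
  | omegaInv t => - t.expSum j

/-- The matrix `M(w_1, …, w_n)` of exponent sums. -/
def expMatrix {n : ℕ} (w : Fin n → KTerm n) : Matrix (Fin n) (Fin n) ℤ :=
  Matrix.of fun i j => (w i).expSum j

/-- The signature `σ`: `κ` together with all operations
`(a_j ∘ (w_1, …, w_n) ^ ω) ^ (m ^ ω)` where `w_1, …, w_n` are `κ`-terms with
`det M(w_1, …, w_n) ≠ 0` and `m ≥ 1` is divisible by every prime dividing this determinant. -/
noncomputable def sigma : ImplicitSignature where
  ops := kappa.ops ∪
    {f | ∃ (n : ℕ) (w : Fin n → KTerm n) (j : Fin n) (m : ℕ) (hm : 0 < m),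
      (expMatrix w).det ≠ 0 ∧
      (∀ p : ℕ, p.Prime → (p : ℤ) ∣ (expMatrix w).det → p ∣ m) ∧
      f = ⟨n, (PW.operatorOmega (fun i => (w i).eval) j).powOmega m hm⟩}
  mul_mem := Or.inl kappa.mul_mem

/-- `Ω^τ_A V`: the `τ`-subalgebra of `Ω̄_A V` generated by `A`. -/
inductive InOmega (τ : ImplicitSignature) (V : Pseudovariety) (A : Type) : PW V A → Prop
  | letter (a : A) : InOmega τ V A (PW.letter V a)
  | op (n : ℕ) (f : PW allSemigroups (Fin n)) (hf : ⟨n, f⟩ ∈ τ.ops) (u : Fin n → PW V A)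
      (hu : ∀ i, InOmega τ V A (u i)) : InOmega τ V A (f.subst u)

/-! ## Systems of equations and reducibility -/

/-- A finite system of equations with finite sets `X` of variables and `P` of parameters, rational
constraints `L x ⊆ A*` on the variables, and values `w p ∈ Ω̄_A 𝖲` of the parameters. -/
structure EqSystem (A : Type) : Type 1 where
  X : Type
  P : Type
  finX : Finite X
  finP : Finite P
  numEq : ℕ
  lhs : Fin numEq → PW allSemigroups (X ⊕ P)
  rhs : Fin numEq → PW allSemigroups (X ⊕ P)
  L : X → Language A
  regular : ∀ x, (L x).IsRegular
  w : P → PW allSemigroups A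

/-- `Cl(L)`: the closure in `Ω̄_A 𝖲` of the set of (non-empty) words of a language `L`. -/
def Cl {A : Type} (L : Language A) : Set (PW allSemigroups A) :=
  closure {v | ∃ u : FreeSemigroup A, u.head :: u.tail ∈ L ∧
    FreeSemigroup.lift (PW.letter allSemigroups) u = v}

namespace EqSystem

variable {A : Type}

/-- `δ` is a solution of the system modulo `V` satisfying the constraints. -/
structure IsSolution (E : EqSystem A) (V : Pseudovariety)
    (δ : E.X ⊕ E.P → PW allSemigroups A) : Prop where
  constraint : ∀ x, δ (Sum.inl x) ∈ Cl (E.L x)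
  param : ∀ p, δ (Sum.inr p) = E.w p
  eqn : ∀ i, PW.psi V ((E.lhs i).subst δ) = PW.psi V ((E.rhs i).subst δ)

/-- The equations are between `τ`-terms, and the parameters take values in `Ω^τ_A 𝖲`. -/
structure IsTermSystem (E : EqSystem A) (τ : ImplicitSignature) : Prop where
  lhs : ∀ i, InOmega τ allSemigroups (E.X ⊕ E.P) (E.lhs i)
  rhs : ∀ i, InOmega τ allSemigroups (E.X ⊕ E.P) (E.rhs i)
  param : ∀ p, InOmega τ allSemigroups A (E.w p)

/-- `V` is `τ`-reducible for the system: if there is a solution modulo `V`, then there is one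
with values in `Ω^τ_A 𝖲`. -/
def Reducible (E : EqSystem A) (τ : ImplicitSignature) (V : Pseudovariety) : Prop :=
  (∃ δ, E.IsSolution V δ) →
    ∃ δ, E.IsSolution V δ ∧ ∀ y, InOmega τ allSemigroups A (δ y)

end EqSystem

/-- `V` is completely `τ`-reducible. -/
def CompletelyReducible (τ : ImplicitSignature) (V : Pseudovariety) : Prop :=
  ∀ (A : Type) [Finite A] (E : EqSystem A), E.IsTermSystem τ → E.Reducible τ V

/-! ## The equation `[x²a, y⁻¹z²by] = 1` with `x ∈ a*`, `z ∈ b*`, `y ∈ A*`, `A = {a, b}` -/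

/-- The commutator `[u, v]` in the language of `κ`. -/
noncomputable def commPW {A : Type} (u v : PW allSemigroups A) : PW allSemigroups A :=
  u * v * u.omegaInv * v.omegaInv

open scoped Computability in
theorem isRegular_kstar_letter (c : Fin 2) : (({[c]} : Language (Fin 2))∗).IsRegular := by
  have hmem : ∀ l : List (Fin 2), l ∈ (({[c]} : Language (Fin 2))∗) ↔ ∀ d ∈ l, d = c := by
    intro l
    rw [Language.mem_kstar]
    constructor
    · rintro ⟨L, rfl, hL⟩ d hd
      obtain ⟨s, hs, hds⟩ := List.mem_flatten.1 hd
      have : s = [c] := hL s hs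
      subst this
      simpa using hds
    · intro h
      refine ⟨l.map fun d => [d], (List.flatMap_singleton' l).symm, ?_⟩
      intro s hs
      obtain ⟨d, hd, rfl⟩ := List.mem_map.1 hs
      rw [h d hd]
      rfl
  let M : DFA (Fin 2) Bool := ⟨fun s d => s && decide (d = c), true, {true}⟩
  have hev : ∀ (l : List (Fin 2)) (s : Bool),
      M.evalFrom s l = true ↔ s = true ∧ ∀ d ∈ l, d = c := by
    intro l
    induction l with
    | nil => intro s; simp
    | cons d l ih =>
      intro s
      rw [DFA.evalFrom_cons, ih]
      simp [M, and_assoc]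
  refine ⟨Bool, inferInstance, M, ?_⟩
  ext l
  rw [hmem, DFA.mem_accepts]
  exact (hev l true).trans (and_iff_right rfl)

theorem isRegular_top_two : (⊤ : Language (Fin 2)).IsRegular := by
  refine ⟨Unit, inferInstance, ⟨fun _ _ => (), (), Set.univ⟩, ?_⟩
  ext l
  rw [DFA.mem_accepts]
  exact iff_of_true trivial trivial

open scoped Computability in
/-- The system consisting of the equation `[x²a, y⁻¹z²by] = 1` over the alphabet
`A = {a, b} = Fin 2`, with variables `x, y, z = 0, 1, 2`, whose constraints are `x ∈ a*`,
`y ∈ A*`, `z ∈ b*`, and with the letters `a, b` as parameters. Inverses are `(ω - 1)`-powers and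
the right-hand side `1` is `x ^ (ω - 1) x`. -/
noncomputable def witness : EqSystem (Fin 2) :=
  let x : PW allSemigroups (Fin 3 ⊕ Fin 2) := PW.letter _ (Sum.inl 0)
  let y : PW allSemigroups (Fin 3 ⊕ Fin 2) := PW.letter _ (Sum.inl 1)
  let z : PW allSemigroups (Fin 3 ⊕ Fin 2) := PW.letter _ (Sum.inl 2)
  let a : PW allSemigroups (Fin 3 ⊕ Fin 2) := PW.letter _ (Sum.inr 0)
  let b : PW allSemigroups (Fin 3 ⊕ Fin 2) := PW.letter _ (Sum.inr 1)
  { X := Fin 3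
    P := Fin 2
    finX := inferInstance
    finP := inferInstance
    numEq := 1
    lhs := fun _ => commPW (x * x * a) (y.omegaInv * (z * z) * b * y)
    rhs := fun _ => x.omegaInv * x
    L := ![({[0]} : Language (Fin 2))∗, ⊤, ({[1]} : Language (Fin 2))∗]
    regular := by
      intro i
      fin_cases i
      · exact isRegular_kstar_letter 0
      · exact isRegular_top_two
      · exact isRegular_kstar_letter 1
    w := PW.letter allSemigroups }

end Pseudo

open scoped commutatorElement

/-!
# Non-reducibility of `𝖦_p` and `𝖦_nil` for the signature `σ`

On a finite `p`-group the operations of `σ` collapse. If `p ∤ det M(w₁, …, wₙ)`, the operator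
`(w₁, …, wₙ)` is injective on `n`-tuples (`injective_operator`), so its `ω`-power is the identity;
and `x ^ (m ^ ω)` is `x` or `1` according to whether `p ∤ m` or `p ∣ m`. By the divisibility
condition relating `m` to the determinant, each new operation of `σ` is therefore a projection or
the constant `1` (`sigma_op_Gp`). Hence `Ω^σ_A 𝖦_p` is the subgroup generated by the letters, and it
is free since free groups are residually finite `p`-groups (`exists_isPGroup_lift_ne_one`): Sanov's
matrices with off-diagonal entry `p²` generate a free group, by ping-pong, and become elements of a
finite `p`-group modulo `p ^ k`.

Consequently a solution of the equation in `σ`-terms modulo `𝖦_p` gives a solution in the free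
group. There is none, as one sees by mapping `a, b` to `i, j` in the quaternion group: squares are
central there, and `±i` does not commute with `±j` (`not_exists_freeGroup_solution`). On the other
hand, `x = a ^ (-1/2)` makes sense in groups of odd order and solves the equation, because then
`x²a = 1` (`lhs_halfSolution_op_of_odd`).

For `𝖦_nil` the left-hand side of the equation is raised to the power `2 ^ ω`, which trivializes it
on `2`-groups and does not affect it on `p`-groups for odd `p`. The same assignment is then a
solution modulo `𝖦_nil`, and a solution in `σ`-terms would be one of the original equation modulo
`𝖦_3`.
-/

namespace Pseudo

/-! ### Free groups are residually finite `p`-groups -/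

/-- The principal congruence subgroup of level `p` in `SL₂(R)`: the matrices of the form
`1 + p M`. -/
def congruenceSubgroup (p : ℕ) (R : Type) [CommRing R] :
    Subgroup (Matrix.SpecialLinearGroup (Fin 2) R) where
  carrier := {g | ∃ M : Matrix (Fin 2) (Fin 2) R,
    (g : Matrix (Fin 2) (Fin 2) R) = 1 + (p : Matrix (Fin 2) (Fin 2) R) * M}
  one_mem' := ⟨0, by simp⟩
  mul_mem' := by
    rintro g h ⟨M, hM⟩ ⟨N, hN⟩
    refine ⟨M + N + M * p * N, ?_⟩
    rw [Matrix.SpecialLinearGroup.coe_mul, hM, hN]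
    noncomm_ring
  inv_mem' := by
    rintro g ⟨M, hM⟩
    refine ⟨-(M * (g⁻¹ : Matrix.SpecialLinearGroup (Fin 2) R)), ?_⟩
    have h : (g : Matrix (Fin 2) (Fin 2) R) * (g⁻¹ : Matrix.SpecialLinearGroup (Fin 2) R) = 1 := by
      rw [← Matrix.SpecialLinearGroup.coe_mul, mul_inv_cancel, Matrix.SpecialLinearGroup.coe_one]
    rw [hM, add_mul, one_mul] at h
    rw [mul_neg, ← mul_assoc, ← sub_eq_add_neg]
    exact eq_sub_of_add_eq h

theorem one_add_mul_pow_eq_one {R : Type*} [Ring R] {p k : ℕ} (h : ((p ^ k : ℕ) : R) = 0) (M : R) :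
    (1 + (p : R) * M) ^ p ^ k = 1 := by
  -- The congruence `(1 + pX) ^ (p ^ k) ≡ 1` modulo `p ^ (k + 1)` holds in `ℤ[X]`; evaluate at `M`.
  have hd : ((p : Polynomial ℤ)) ∣ (1 + (p : Polynomial ℤ) * Polynomial.X) - 1 :=
    ⟨Polynomial.X, by ring⟩
  obtain ⟨Q, hQ⟩ := dvd_sub_pow_of_dvd_sub hd k
  have h2 := congrArg (Polynomial.aeval M) hQ
  simp only [map_sub, map_pow, map_add, map_mul, map_one, map_natCast, Polynomial.aeval_X,
    one_pow] at h2
  rw [pow_succ, ← Nat.cast_pow, h, zero_mul, zero_mul] at h2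
  exact sub_eq_zero.1 h2

theorem isPGroup_congruenceSubgroup (p k : ℕ) :
    IsPGroup p (congruenceSubgroup p (ZMod (p ^ k))) := by
  rintro ⟨g, M, hM⟩
  refine ⟨k, Subtype.ext (Subtype.ext ?_)⟩
  change ((g ^ p ^ k : Matrix.SpecialLinearGroup (Fin 2) (ZMod (p ^ k))) :
    Matrix (Fin 2) (Fin 2) (ZMod (p ^ k))) = 1
  rw [Matrix.SpecialLinearGroup.coe_pow, hM]
  refine one_add_mul_pow_eq_one ?_ M
  rw [← map_natCast (algebraMap (ZMod (p ^ k)) (Matrix (Fin 2) (Fin 2) (ZMod (p ^ k)))),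
    ZMod.natCast_self, map_zero]

open Matrix in
/-- Sanov's matrices: the two elementary matrices with off-diagonal entry `q`. -/
def sanov (R : Type) [CommRing R] (q : R) : Fin 2 → Matrix.SpecialLinearGroup (Fin 2) R :=
  ![⟨!![1, q; 0, 1], by simp⟩, ⟨!![1, 0; q, 1], by simp⟩]

/-- The ping-pong estimate for one elementary matrix, on coordinates `x, y`. -/
theorem sanov_estimate {q x y : ℤ} (hq : 4 ≤ q) (hxy : x ≠ 0 ∨ y ≠ 0)
    (h : ¬ (|y| < |x| ∧ x * y < 0)) : |y| < |x + q * y| ∧ 0 ≤ (x + q * y) * y := by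
  rcases lt_trichotomy y 0 with hy | rfl | hy
  · have hx : x ≤ -y := by
      by_contra hx
      push Not at hx
      exact h ⟨by rw [abs_of_neg hy, abs_of_pos (by omega)]; exact hx, by nlinarith⟩
    have h1 : x + q * y < y := by nlinarith
    rw [abs_of_neg hy, abs_of_neg (by omega)]
    exact ⟨by omega, by nlinarith⟩
  · simp only [mul_zero, add_zero, abs_zero, abs_pos, le_refl, and_true]
    simpa using hxy
  · have hx : -y ≤ x := by
      by_contra hx
      push Not at hx
      exact h ⟨by rw [abs_of_pos hy, abs_of_neg (by omega)]; omega, by nlinarith⟩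
    have h1 : y < x + q * y := by nlinarith
    rw [abs_of_pos hy, abs_of_pos (by omega)]
    exact ⟨by omega, by nlinarith⟩

/-- The ping-pong estimate for the inverse of an elementary matrix. -/
theorem sanov_estimate_inv {q x y : ℤ} (hq : 4 ≤ q) (hxy : x ≠ 0 ∨ y ≠ 0)
    (h : ¬ (|y| < |x| ∧ 0 ≤ x * y)) :
    |y| < |x - q * y| ∧ (x - q * y) * y < 0 := by
  have hy0 : y ≠ 0 := by
    rintro rfl
    exact h ⟨by simpa using hxy, by simp⟩
  rcases lt_or_gt_of_ne hy0 with hy | hy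
  · have hx : y ≤ x := by
      by_contra hx
      push Not at hx
      exact h ⟨by rw [abs_of_neg hy, abs_of_neg (by omega)]; omega, by nlinarith⟩
    have h1 : -y < x - q * y := by nlinarith
    rw [abs_of_neg hy, abs_of_pos (by omega)]
    exact ⟨by omega, by nlinarith⟩
  · have hx : x ≤ y := by
      by_contra hx
      push Not at hx
      exact h ⟨by rw [abs_of_pos hy, abs_of_pos (by omega)]; omega, by nlinarith⟩
    have h1 : x - q * y < -y := by nlinarith
    rw [abs_of_pos hy, abs_of_neg (by omega)]
    exact ⟨by omega, by nlinarith⟩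

theorem firstColumn_ne_zero (g : Matrix.SpecialLinearGroup (Fin 2) ℤ) : g 0 0 ≠ 0 ∨ g 1 0 ≠ 0 := by
  by_contra! h
  have := g.det_coe
  rw [Matrix.det_fin_two] at this
  simp [h.1, h.2] at this

theorem sanov_mul_apply (q : ℤ) (i : Fin 2) (g : Matrix.SpecialLinearGroup (Fin 2) ℤ) :
    (sanov ℤ q i * g) i 0 = g i 0 + q * g (i + 1) 0 ∧
      (sanov ℤ q i * g) (i + 1) 0 = g (i + 1) 0 := by
  rw [Matrix.SpecialLinearGroup.coe_mul, Matrix.mul_apply, Matrix.mul_apply, Fin.sum_univ_two,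
    Fin.sum_univ_two]
  fin_cases i <;> simp [sanov, add_comm]

theorem sanov_inv_mul_apply (q : ℤ) (i : Fin 2) (g : Matrix.SpecialLinearGroup (Fin 2) ℤ) :
    ((sanov ℤ q i)⁻¹ * g) i 0 = g i 0 - q * g (i + 1) 0 ∧
      ((sanov ℤ q i)⁻¹ * g) (i + 1) 0 = g (i + 1) 0 := by
  have h := sanov_mul_apply q i ((sanov ℤ q i)⁻¹ * g)
  rw [mul_inv_cancel_left] at h
  refine ⟨?_, h.2.symm⟩
  rw [h.1, h.2]
  ring

open scoped Pointwise in
/-- Sanov's theorem. The group acts on itself by left multiplication, and ping-pong is played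
with the first column. -/
theorem injective_lift_sanov {q : ℤ} (hq : 4 ≤ q) :
    Function.Injective (FreeGroup.lift (sanov ℤ q)) := by
  let X : Fin 2 → Set (Matrix.SpecialLinearGroup (Fin 2) ℤ) := fun i =>
    {g | |g (i + 1) 0| < |g i 0| ∧ 0 ≤ g i 0 * g (i + 1) 0}
  let Y : Fin 2 → Set (Matrix.SpecialLinearGroup (Fin 2) ℤ) := fun i =>
    {g | |g (i + 1) 0| < |g i 0| ∧ g i 0 * g (i + 1) 0 < 0}
  have hne : ∀ (i : Fin 2) (g : Matrix.SpecialLinearGroup (Fin 2) ℤ), g i 0 ≠ 0 ∨ g (i + 1) 0 ≠ 0 := by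
    intro i g
    fin_cases i
    · exact firstColumn_ne_zero g
    · exact (firstColumn_ne_zero g).symm
  have hlt : ∀ (i j : Fin 2) (g : Matrix.SpecialLinearGroup (Fin 2) ℤ), i ≠ j →
      |g (i + 1) 0| < |g i 0| →
      ¬ |g (j + 1) 0| < |g j 0| := by
    intro i j g hij h
    obtain rfl : j = i + 1 := by omega
    rw [show i + 1 + 1 = i by omega]
    exact h.le.not_gt
  refine FreeGroup.injective_lift_of_ping_pong (sanov ℤ q) X Y ?_ ?_ ?_ ?_ ?_ ?_
  · intro i
    fin_cases i
    · exact ⟨1, by simp [X]⟩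
    · refine ⟨⟨!![0, -1; 1, 0], by simp⟩, ?_⟩
      change |(0 : ℤ)| < |(1 : ℤ)| ∧ (0 : ℤ) ≤ 1 * 0
      norm_num
  · intro i j hij
    exact Set.disjoint_left.2 fun g h h' => hlt i j g hij h.1 h'.1
  · intro i j hij
    exact Set.disjoint_left.2 fun g h h' => hlt i j g hij h.1 h'.1
  · intro i j
    refine Set.disjoint_left.2 fun g h h' => ?_
    rcases eq_or_ne i j with rfl | hij
    · exact h.2.not_gt h'.2
    · exact hlt i j g hij h.1 h'.1
  · rintro i _ ⟨g, hg, rfl⟩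
    change sanov ℤ q i * g ∈ X i
    rw [Set.mem_ofPred_eq, (sanov_mul_apply q i g).1, (sanov_mul_apply q i g).2]
    exact sanov_estimate hq (hne i g) hg
  · rintro i _ ⟨g, hg, rfl⟩
    change (sanov ℤ q i)⁻¹ * g ∈ Y i
    rw [Set.mem_ofPred_eq, (sanov_inv_mul_apply q i g).1, (sanov_inv_mul_apply q i g).2]
    exact sanov_estimate_inv hq (hne i g) hg

/-- Free groups of rank two are residually finite `p`-groups. -/
theorem exists_isPGroup_lift_ne_one {p : ℕ} (hp : p.Prime) {w : FreeGroup (Fin 2)} (hw : w ≠ 1) :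
    ∃ (G : Type) (_ : Group G), Finite G ∧ IsPGroup p G ∧
      ∃ φ : Fin 2 → G, FreeGroup.lift φ w ≠ 1 := by
  -- The entry is `p ^ 2` and not `p` because the strict estimates of ping-pong fail for the entry
  -- `2`.
  have hq : (4 : ℤ) ≤ (p : ℤ) ^ 2 := by
    have : (2 : ℤ) ≤ p := by exact_mod_cast hp.two_le
    nlinarith
  have hg : FreeGroup.lift (sanov ℤ ((p : ℤ) ^ 2)) w ≠ 1 := fun h =>
    hw (injective_lift_sanov hq (h.trans (map_one _).symm))
  set g := FreeGroup.lift (sanov ℤ ((p : ℤ) ^ 2)) w with hgdef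
  obtain ⟨i, j, hij⟩ : ∃ i j, g i j ≠ (1 : Matrix (Fin 2) (Fin 2) ℤ) i j := by
    by_contra! h
    exact hg (Matrix.SpecialLinearGroup.ext _ _ h)
  -- Reduction modulo `p ^ k` detects the entry where `g` differs from the identity.
  obtain ⟨k, hk⟩ : ∃ k : ℕ, ¬ ((p ^ k : ℕ) : ℤ) ∣ g i j - (1 : Matrix (Fin 2) (Fin 2) ℤ) i j := by
    refine ⟨(g i j - (1 : Matrix (Fin 2) (Fin 2) ℤ) i j).natAbs, fun h => ?_⟩
    have h1 := Int.natAbs_dvd_natAbs.2 h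
    rw [Int.natAbs_natCast] at h1
    exact absurd (Nat.le_of_dvd (Int.natAbs_pos.2 (sub_ne_zero.2 hij)) h1)
      (not_le.2 (Nat.lt_pow_self hp.one_lt))
  have : NeZero (p ^ k) := ⟨pow_ne_zero _ hp.ne_zero⟩
  have hmem : ∀ i, sanov (ZMod (p ^ k)) ((p : ZMod (p ^ k)) ^ 2) i ∈
      congruenceSubgroup p (ZMod (p ^ k)) := by
    have hcast : (p : Matrix (Fin 2) (Fin 2) (ZMod (p ^ k))) =
        (p : ZMod (p ^ k)) • (1 : Matrix (Fin 2) (Fin 2) (ZMod (p ^ k))) := by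
      rw [Nat.cast_smul_eq_nsmul, nsmul_one]
    intro i
    fin_cases i
    · refine ⟨!![0, p; 0, 0], ?_⟩
      rw [hcast]
      ext i j
      fin_cases i <;> fin_cases j <;> simp [sanov, pow_two]
    · refine ⟨!![0, 0; p, 0], ?_⟩
      rw [hcast]
      ext i j
      fin_cases i <;> fin_cases j <;> simp [sanov, pow_two]
  let φ : Fin 2 → congruenceSubgroup p (ZMod (p ^ k)) := fun i =>
    ⟨sanov (ZMod (p ^ k)) ((p : ZMod (p ^ k)) ^ 2) i, hmem i⟩
  refine ⟨congruenceSubgroup p (ZMod (p ^ k)), inferInstance, inferInstance,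
    isPGroup_congruenceSubgroup p k, φ, fun h => ?_⟩
  have hcomp : (congruenceSubgroup p (ZMod (p ^ k))).subtype.comp (FreeGroup.lift φ) =
      (Matrix.SpecialLinearGroup.map (Int.castRingHom (ZMod (p ^ k)))).comp
        (FreeGroup.lift (sanov ℤ ((p : ℤ) ^ 2))) := by
    ext a : 1
    simp only [MonoidHom.comp_apply, FreeGroup.lift_apply_of]
    apply Matrix.SpecialLinearGroup.ext
    intro i j
    rw [Matrix.SpecialLinearGroup.map_apply_coe, RingHom.mapMatrix_apply, Matrix.map_apply]
    fin_cases a <;> fin_cases i <;> fin_cases j <;> simp [φ, sanov]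
  have h1 := DFunLike.congr_fun hcomp w
  rw [MonoidHom.comp_apply, MonoidHom.comp_apply, h, map_one, ← hgdef] at h1
  have h2 := congrArg (fun s : Matrix.SpecialLinearGroup (Fin 2) (ZMod (p ^ k)) => s i j) h1
  apply hk
  rw [← ZMod.intCast_zmod_eq_zero_iff_dvd]
  rw [Matrix.SpecialLinearGroup.map_apply_coe, RingHom.mapMatrix_apply, Matrix.map_apply] at h2
  rw [Int.cast_sub, sub_eq_zero]
  refine h2.symm.trans ?_
  change (1 : Matrix (Fin 2) (Fin 2) (ZMod (p ^ k))) i j = _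
  rw [Matrix.one_apply, Matrix.one_apply]
  split_ifs <;> simp

/-! ### The equation has no solution in the free group -/

open scoped commutatorElement in
theorem not_exists_freeGroup_solution : ¬ ∃ x y z : FreeGroup (Fin 2),
    ⁅x ^ 2 * FreeGroup.of 0, y⁻¹ * z ^ 2 * FreeGroup.of 1 * y⁆ = 1 := by
  rintro ⟨x, y, z, h⟩
  -- In the quaternion group, with generators `i` and `j`, all squares are central.
  have hQ : ∀ x y z : QuaternionGroup 2,
      ⁅x ^ 2 * QuaternionGroup.a 1, y⁻¹ * z ^ 2 * QuaternionGroup.xa 0 * y⁆ ≠ 1 := by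
    decide
  let f : FreeGroup (Fin 2) →* QuaternionGroup 2 :=
    FreeGroup.lift ![QuaternionGroup.a 1, QuaternionGroup.xa 0]
  refine hQ (f x) (f y) (f z) ?_
  have := congrArg f h
  simpa [map_commutatorElement, f] using this

/-! ### Matrices acting on abelian groups -/

theorem det_smul_eq_zero {n : ℕ} {N : Type*} [AddCommGroup N] (M : Matrix (Fin n) (Fin n) ℤ)
    (z : Fin n → N) (h : ∀ i, ∑ j, M i j • z j = 0) (l : Fin n) : M.det • z l = 0 := by
  have h1 : ∑ i, M.adjugate l i • ∑ j, M i j • z j = 0 :=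
    Finset.sum_eq_zero fun i _ => by rw [h i, smul_zero]
  simp only [Finset.smul_sum, smul_smul] at h1
  rw [Finset.sum_comm] at h1
  simp only [← Finset.sum_smul, ← Matrix.mul_apply, Matrix.adjugate_mul] at h1
  simpa [Matrix.smul_apply, Matrix.one_apply, ite_smul] using h1

/-! ### Pseudowords evaluated in finite groups -/

/-- Every member is (isomorphic to) a group. -/
def Pseudovariety.IsGroupal (V : Pseudovariety) : Prop :=
  ∀ (T : Type) [Semigroup T], V.Mem T →
    ∃ (G : Type) (_ : Group G), V.Mem G ∧ Nonempty (T ≃* G)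

theorem mem_Gp {p : ℕ} {G : Type} [Group G] : (Gp p).Mem G ↔ Finite G ∧ IsPGroup p G := by
  constructor
  · rintro ⟨hf, H, _, hH, ⟨e⟩⟩
    exact ⟨hf, hH.of_equiv e.symm⟩
  · rintro ⟨hf, h⟩
    exact ⟨hf, G, inferInstance, h, ⟨MulEquiv.refl G⟩⟩

theorem mem_Gnil {G : Type} [Group G] : Gnil.Mem G ↔ Finite G ∧ Group.IsNilpotent G := by
  constructor
  · rintro ⟨hf, H, _, hH, ⟨e⟩⟩
    have : Group.IsNilpotent H := hH
    exact ⟨hf, Group.nilpotent_of_surjective (e.symm : H →* G) e.symm.surjective⟩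
  · rintro ⟨hf, h⟩
    exact ⟨hf, G, inferInstance, h, ⟨MulEquiv.refl G⟩⟩

theorem isGroupal_Gp (p : ℕ) : (Gp p).IsGroupal := by
  rintro T _ ⟨hf, G, _, hG, ⟨e⟩⟩
  exact ⟨G, inferInstance, mem_Gp.2 ⟨Finite.of_equiv T e.toEquiv, hG⟩, ⟨e⟩⟩

theorem isGroupal_Gnil : Gnil.IsGroupal := by
  rintro T _ ⟨hf, G, _, hG, ⟨e⟩⟩
  exact ⟨G, inferInstance, mem_Gnil.2 ⟨Finite.of_equiv T e.toEquiv, hG⟩, ⟨e⟩⟩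

theorem Gp_mem_Gnil {p : ℕ} (hp : p.Prime) {T : Type} [Semigroup T] (h : (Gp p).Mem T) :
    Gnil.Mem T := by
  obtain ⟨hf, G, _, hG, ⟨e⟩⟩ := h
  have : Fact p.Prime := ⟨hp⟩
  have : Finite G := Finite.of_equiv T e.toEquiv
  exact ⟨hf, G, inferInstance, hG.isNilpotent, ⟨e⟩⟩

namespace PW

variable {V : Pseudovariety} {A : Type}

/-- Over a pseudovariety of groups it suffices to compare implicit operations on groups. -/
theorem ext_of_isGroupal (hV : V.IsGroupal) {u v : PW V A}
    (h : ∀ (G : Type) [Group G] (hG : V.Mem G) (φ : A → G), u.op G hG φ = v.op G hG φ) : u = v := by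
  ext T _ hT φ
  obtain ⟨G, _, hG, ⟨e⟩⟩ := hV T hT
  apply e.injective
  exact (u.natural hT hG (e : T →ₙ* G) φ).trans
    ((h G hG (e ∘ φ)).trans (v.natural hT hG (e : T →ₙ* G) φ).symm)

end PW

theorem spow_eq_pow {M : Type*} [Monoid M] (s : M) {k : ℕ} (hk : 1 ≤ k) : spow s k = s ^ k := by
  obtain ⟨n, rfl⟩ := Nat.exists_eq_add_of_le' hk
  unfold spow
  rw [Nat.add_sub_cancel]
  induction n with
  | zero => simp
  | succ n ih => rw [Function.iterate_succ_apply', ih (by omega), pow_succ _ (n + 1)]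

namespace PW

variable {V : Pseudovariety} {A : Type}

theorem omegaInv_op (u : PW V A) (G : Type) [Group G] (h : V.Mem G) (φ : A → G) :
    u.omegaInv.op G h φ = (u.op G h φ)⁻¹ := by
  have := V.finite h
  obtain ⟨k, hk, h3⟩ := ((lim_op _ (converges_omegaInv u) G h φ).and
    (Filter.eventually_ge_atTop (max 3 (Nat.card G)))).exists
  rw [omegaInv, ← hk, spow_op]
  have h6 : 6 ≤ k.factorial := Nat.factorial_le (le_trans (le_max_left _ _) h3)
  rw [spow_eq_pow _ (by omega)]
  apply eq_inv_of_mul_eq_one_left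
  rw [← pow_succ, Nat.sub_add_cancel (by omega)]
  exact orderOf_dvd_iff_pow_eq_one.1 ((orderOf_dvd_natCard _).trans
    (Nat.dvd_factorial Nat.card_pos (le_trans (le_max_right _ _) h3)))

theorem powOmega_op (u : PW V A) (m : ℕ) (hm : 0 < m) (G : Type) [Group G] (h : V.Mem G)
    (φ : A → G) :
    ∀ᶠ k in Filter.atTop, (u.powOmega m hm).op G h φ = u.op G h φ ^ m ^ Nat.factorial k := by
  filter_upwards [lim_op _ (converges_powOmega u m hm) G h φ] with k hk
  rw [powOmega, ← hk, spow_op, spow_eq_pow _ (Nat.one_le_pow _ _ hm)]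

/-- If `p ∣ m`, then `m ^ ω = 0` in the `p`-adic integers. -/
theorem powOmega_op_eq_one {p m : ℕ} (hm : 0 < m) (hpm : p ∣ m) (u : PW V A) (G : Type) [Group G]
    (h : V.Mem G) (φ : A → G) (hu : ∃ l, u.op G h φ ^ p ^ l = 1) :
    (u.powOmega m hm).op G h φ = 1 := by
  obtain ⟨l, hl⟩ := hu
  obtain ⟨k, hk, hkl⟩ := ((powOmega_op u m hm G h φ).and (Filter.eventually_ge_atTop l)).exists
  have hd : p ^ l ∣ m ^ k.factorial :=
    (pow_dvd_pow p (hkl.trans k.self_le_factorial)).trans (pow_dvd_pow_of_dvd hpm _)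
  obtain ⟨c, hc⟩ := hd
  rw [hk, hc, pow_mul, hl, one_pow]

/-- If `p ∤ m`, then `m ^ ω = 1` in the `p`-adic integers. -/
theorem powOmega_op_eq_self {p m : ℕ} (hp : p.Prime) (hm : 0 < m) (hpm : ¬ p ∣ m) (u : PW V A)
    (G : Type) [Group G] (hG : IsPGroup p G) (h : V.Mem G) (φ : A → G) :
    (u.powOmega m hm).op G h φ = u.op G h φ := by
  obtain ⟨l, hl⟩ := hG (u.op G h φ)
  obtain ⟨k, hk, hkl⟩ := ((powOmega_op u m hm G h φ).and
    (Filter.eventually_ge_atTop (p ^ l).totient)).exists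
  rw [hk]
  conv_rhs => rw [← pow_one (u.op G h φ)]
  rw [pow_eq_pow_iff_modEq]
  refine Nat.ModEq.of_dvd (orderOf_dvd_of_pow_eq_one hl) ?_
  obtain ⟨c, hc⟩ := Nat.dvd_factorial (Nat.totient_pos.2 (pow_pos hp.pos l)) hkl
  have hcop : Nat.Coprime m (p ^ l) :=
    ((Nat.Prime.coprime_iff_not_dvd hp).2 hpm).symm.pow_right l
  rw [hc, pow_mul]
  simpa using (Nat.ModEq.pow_totient hcop).pow c

end PW

/-! ### Operators with determinant prime to `p` -/

open scoped IsMulCommutative in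
/-- Multiplying the arguments by central elements multiplies the value of a `κ`-term by the
central element given by the exponent sums. -/
theorem KTerm.eval_op_mul_central {n : ℕ} (t : KTerm n) {G : Type} [Group G]
    (h : allSemigroups.Mem G) (g : Fin n → G) (z : Fin n → Subgroup.center G) :
    t.eval.op G h (fun i => g i * z i) =
      t.eval.op G h g * ((∏ j, z j ^ t.expSum j : Subgroup.center G) : G) := by
  have hc : ∀ (c : Subgroup.center G) (x : G), (c : G) * x = x * c := fun c x =>
    (Subgroup.mem_center_iff.1 c.2 x).symm
  induction t with
  | var i =>
    simp only [KTerm.eval, KTerm.expSum, PW.letter]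
    rw [Finset.prod_eq_single i]
    · simp
    · intro j _ hj
      simp [hj.symm]
    · simp
  | mul s t hs ht =>
    simp only [KTerm.eval, KTerm.expSum, PW.mul_op, zpow_add, Finset.prod_mul_distrib, hs, ht,
      Subgroup.coe_mul]
    rw [mul_assoc, ← mul_assoc _ (t.eval.op G h g), hc]
    simp only [mul_assoc]
  | omegaInv t ht =>
    simp only [KTerm.eval, KTerm.expSum, PW.omegaInv_op, zpow_neg, Finset.prod_inv_distrib, ht,
      mul_inv_rev, Subgroup.coe_inv]
    rw [← Subgroup.coe_inv, hc]

open scoped IsMulCommutative in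
/-- If `p` does not divide the determinant of the exponent sums, the operator given by `κ`-terms is
injective on finite `p`-groups. By induction on the nilpotency class: modulo the centre two tuples
with the same image agree, and on the centre the operator acts through the matrix. -/
theorem injective_operator {p n : ℕ} (hp : p.Prime) (w : Fin n → KTerm n)
    (hw : ¬ (p : ℤ) ∣ (expMatrix w).det) (G : Type) [Group G] [Group.IsNilpotent G]
    (h : allSemigroups.Mem G) (hG : IsPGroup p G) :
    Function.Injective (fun (s : Fin n → G) i => (w i).eval.op G h s) := by
  revert h hG
  refine Group.nilpotent_center_quotient_ind
    (P := fun G _ _ => ∀ (h : allSemigroups.Mem G) (_ : IsPGroup p G),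
      Function.Injective (fun (s : Fin n → G) i => (w i).eval.op G h s)) G ?_ ?_
  · intro G _ _ h _ s t _
    exact Subsingleton.elim s t
  · intro G _ _ ih h hG s t hst
    let π : G →* G ⧸ Subgroup.center G := QuotientGroup.mk' _
    have hQ : allSemigroups.Mem (G ⧸ Subgroup.center G) :=
      allSemigroups.of_surjective (π : G →ₙ* G ⧸ Subgroup.center G)
        (QuotientGroup.mk'_surjective _) h
    have hnat : ∀ (s : Fin n → G) i,
        π ((w i).eval.op G h s) = (w i).eval.op _ hQ (π ∘ s) := fun s i =>
      (w i).eval.natural h hQ (π : G →ₙ* G ⧸ Subgroup.center G) s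
    have hπ : π ∘ s = π ∘ t := by
      refine ih hQ (hG.to_quotient _) (funext fun i => ?_)
      change (w i).eval.op _ hQ (π ∘ s) = (w i).eval.op _ hQ (π ∘ t)
      rw [← hnat, ← hnat]
      exact congrArg π (congrFun hst i)
    have hz : ∀ i, (s i)⁻¹ * t i ∈ Subgroup.center G := fun i =>
      QuotientGroup.eq.1 (congrFun hπ i)
    let z : Fin n → Subgroup.center G := fun i => ⟨(s i)⁻¹ * t i, hz i⟩
    have ht : t = fun i => s i * z i := funext fun i => by simp [z]
    have hprod : ∀ i, ∏ j, z j ^ (w i).expSum j = 1 := by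
      intro i
      have h1 := congrFun hst i
      simp only at h1
      rw [ht, KTerm.eval_op_mul_central] at h1
      exact Subtype.ext (left_eq_mul.1 h1)
    have hdet : ∀ l, z l ^ (expMatrix w).det = 1 := fun l =>
      det_smul_eq_zero (N := Additive (Subgroup.center G)) (expMatrix w) z hprod l
    have hz1 : ∀ l, z l = 1 := by
      intro l
      obtain ⟨k, hk⟩ := hG.to_subgroup (Subgroup.center G) (z l)
      have hcop : IsCoprime (((p ^ k : ℕ) : ℤ)) (expMatrix w).det := by
        rw [Nat.cast_pow]
        exact IsCoprime.pow_left
          (((Nat.prime_iff_prime_int.1 hp).coprime_iff_not_dvd).2 hw)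
      obtain ⟨a, b, hab⟩ := hcop
      rw [← zpow_one (z l), ← hab, zpow_add, mul_comm a, mul_comm b, zpow_mul, zpow_mul, hdet,
        zpow_natCast, hk, one_zpow, one_zpow, one_mul]
    rw [ht]
    funext i
    simp [hz1]

/-- The `ω`-power of an operator that is injective on a finite semigroup is the identity there. -/
theorem PW.operatorOmega_op {n : ℕ} (w : Fin n → PW allSemigroups (Fin n)) (j : Fin n) (T : Type)
    [Semigroup T] (h : allSemigroups.Mem T)
    (hw : Function.Injective (fun (s : Fin n → T) i => (w i).op T h s)) (φ : Fin n → T) :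
    (PW.operatorOmega w j).op T h φ = φ j := by
  have : Finite T := h.1
  let g : Equiv.Perm (Fin n → T) := Equiv.ofBijective _ hw.bijective_of_finite
  obtain ⟨k, hk, hkg⟩ := ((lim_op _ (converges_operatorOmega w j) T h φ).and
    (Filter.eventually_ge_atTop (Nat.card (Equiv.Perm (Fin n → T))))).exists
  rw [operatorOmega, ← hk]
  have h1 : g ^ k.factorial = 1 := orderOf_dvd_iff_pow_eq_one.1 ((orderOf_dvd_natCard g).trans
    (Nat.dvd_factorial Nat.card_pos hkg))
  have h2 := congrFun (operatorPow_op w k.factorial T h φ) j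
  refine h2.trans ?_
  change (g^[k.factorial]) φ j = φ j
  rw [← Equiv.Perm.coe_pow, h1]
  rfl

/-- On `𝖦_p` every operation of `σ` outside `κ` is either a projection or constantly `1`. -/
theorem sigma_op_Gp {p n m : ℕ} (hp : p.Prime) (w : Fin n → KTerm n) (j : Fin n) (hm : 0 < m)
    (hdet : ∀ q : ℕ, q.Prime → (q : ℤ) ∣ (expMatrix w).det → q ∣ m) :
    (∀ (G : Type) [Group G] (h : (Gp p).Mem G) (s : Fin n → G),
      ((PW.operatorOmega (fun i => (w i).eval) j).powOmega m hm).op G ((Gp p).mem_all h) s = 1) ∨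
    (∀ (G : Type) [Group G] (h : (Gp p).Mem G) (s : Fin n → G),
      ((PW.operatorOmega (fun i => (w i).eval) j).powOmega m hm).op G ((Gp p).mem_all h) s =
        s j) := by
  by_cases hpm : p ∣ m
  · left
    intro G _ h s
    exact PW.powOmega_op_eq_one hm hpm _ G _ s ((mem_Gp.1 h).2 _)
  · right
    intro G _ h s
    obtain ⟨hf, hG⟩ := mem_Gp.1 h
    have : Fact p.Prime := ⟨hp⟩
    have : Group.IsNilpotent G := hG.isNilpotent
    rw [PW.powOmega_op_eq_self hp hm hpm _ G hG]
    exact PW.operatorOmega_op _ j G _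
      (injective_operator hp w (fun hd => hpm (hdet p hp hd)) G _ hG) s

/-! ### Closure properties of `Ω^τ_A V` -/

theorem PW.mulOp_subst {V : Pseudovariety} {A : Type} (u : Fin 2 → PW V A) :
    mulOp.subst u = u 0 * u 1 := rfl

theorem PW.omegaInvOp_subst {V : Pseudovariety} {A : Type} (u : Fin 1 → PW V A) :
    omegaInvOp.subst u = (u 0).omegaInv := by
  ext T _ h φ
  obtain ⟨k, hk, hk'⟩ := ((lim_op _ (converges_omegaInv (letter allSemigroups (0 : Fin 1))) T
    (V.mem_all h) (fun y => (u y).op T h φ)).and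
      (lim_op _ (converges_omegaInv (u 0)) T h φ)).exists
  change (lim _ (converges_omegaInv (letter allSemigroups (0 : Fin 1)))).op T _ _ =
    (lim _ (converges_omegaInv (u 0))).op T h φ
  rw [← hk, ← hk', spow_op, spow_op]
  rfl

theorem InOmega.mul {τ : ImplicitSignature} {V : Pseudovariety} {A : Type} {u v : PW V A}
    (hu : InOmega τ V A u) (hv : InOmega τ V A v) : InOmega τ V A (u * v) :=
  InOmega.op 2 mulOp τ.mul_mem ![u, v] (by intro i; fin_cases i <;> assumption)

theorem InOmega.omegaInv {V : Pseudovariety} {A : Type} {u : PW V A}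
    (hu : InOmega sigma V A u) : InOmega sigma V A u.omegaInv := by
  have := InOmega.op (τ := sigma) 1 omegaInvOp (Or.inl (Or.inr rfl)) (fun _ => u) (fun _ => hu)
  rwa [PW.omegaInvOp_subst] at this

/-- The signature `σ` contains `x ^ (m ^ ω)` for each `m ≥ 1`: it arises from the identity
operator in one letter. -/
theorem InOmega.powOmega {A : Type} {u : PW allSemigroups A}
    (hu : InOmega sigma allSemigroups A u) (m : ℕ) (hm : 0 < m) :
    InOmega sigma allSemigroups A (u.powOmega m hm) := by
  have hmem : (⟨1, (PW.operatorOmega (fun i => (KTerm.var i).eval) (0 : Fin 1)).powOmega m hm⟩ :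
      Σ n : ℕ, PW allSemigroups (Fin n)) ∈ sigma.ops := by
    refine Or.inr ⟨1, fun i => KTerm.var i, 0, m, hm, ?_, ?_, rfl⟩
    · simp [expMatrix, KTerm.expSum]
    · intro p hp hd
      have h1 : (expMatrix fun i : Fin 1 => KTerm.var i).det = 1 := by
        simp [expMatrix, KTerm.expSum]
      rw [h1] at hd
      exact absurd (Int.natCast_dvd_natCast.1 hd) hp.not_dvd_one
  have := InOmega.op _ _ hmem (fun _ => u) (fun _ => hu)
  convert this using 1
  ext T _ h φ
  let ψ : Fin 1 → T := fun _ => u.op T h φ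
  obtain ⟨k, hk, hk'⟩ := ((PW.lim_op _ (PW.converges_powOmega u m hm) T h φ).and
    (PW.lim_op _ (PW.converges_powOmega
      (PW.operatorOmega (fun i => (KTerm.var i).eval) (0 : Fin 1)) m hm) T h ψ)).exists
  refine hk.symm.trans (Eq.trans ?_ hk')
  rw [PW.spow_op, PW.spow_op, PW.operatorOmega_op _ _ T h (fun s t hst => hst)]

theorem InOmega.psi {τ : ImplicitSignature} (V : Pseudovariety) {A : Type}
    {u : PW allSemigroups A} (hu : InOmega τ allSemigroups A u) : InOmega τ V A (PW.psi V u) := by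
  induction hu with
  | letter a => exact InOmega.letter a
  | op n f hf u _ ih => exact InOmega.op n f hf (fun i => PW.psi V (u i)) ih

/-! ### The free group inside the free pro-`p` semigroup -/

/-- The free pro-`p` semigroup on two letters is a group, with inversion `u ↦ u ^ (ω - 1)`.
The identity is given by the implicit operation `a ^ (ω - 1) a`. This is not a global instance, so
that the multiplication of a pseudoword semigroup is found in one way only. -/
@[reducible]
noncomputable def PW.groupGp (p : ℕ) : Group (PW (Gp p) (Fin 2)) :=
  { (inferInstance : Semigroup (PW (Gp p) (Fin 2))) with
    one := (PW.letter _ 0).omegaInv * PW.letter _ 0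
    inv := PW.omegaInv
    one_mul := fun u => PW.ext_of_isGroupal (isGroupal_Gp p) fun G _ h φ => by
      change (((PW.letter _ 0).omegaInv * PW.letter _ 0) * u).op G h φ = _
      rw [PW.mul_op, PW.mul_op, PW.omegaInv_op, inv_mul_cancel, one_mul]
    mul_one := fun u => PW.ext_of_isGroupal (isGroupal_Gp p) fun G _ h φ => by
      change (u * ((PW.letter _ 0).omegaInv * PW.letter _ 0)).op G h φ = _
      rw [PW.mul_op, PW.mul_op, PW.omegaInv_op, inv_mul_cancel, mul_one]
    inv_mul_cancel := fun u => PW.ext_of_isGroupal (isGroupal_Gp p) fun G _ h φ => by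
      change (u.omegaInv * u).op G h φ =
        ((PW.letter (Gp p) (0 : Fin 2)).omegaInv * PW.letter (Gp p) 0).op G h φ
      rw [PW.mul_op, PW.mul_op, PW.omegaInv_op, PW.omegaInv_op, inv_mul_cancel, inv_mul_cancel] }

attribute [local instance] PW.groupGp

theorem PW.inv_eq_omegaInv {p : ℕ} (u : PW (Gp p) (Fin 2)) : u⁻¹ = u.omegaInv := rfl

theorem PW.one_op {p : ℕ} (G : Type) [Group G] (h : (Gp p).Mem G) (φ : Fin 2 → G) :
    (1 : PW (Gp p) (Fin 2)).op G h φ = 1 := by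
  change ((PW.letter (Gp p) (0 : Fin 2)).omegaInv * PW.letter (Gp p) 0).op G h φ = 1
  rw [PW.mul_op, PW.omegaInv_op, inv_mul_cancel]

/-- The canonical homomorphism from the free group to the free pro-`p` group. -/
noncomputable def freeGroupToPW (p : ℕ) : FreeGroup (Fin 2) →* PW (Gp p) (Fin 2) :=
  FreeGroup.lift (PW.letter (Gp p))

theorem freeGroupToPW_of (p : ℕ) (a : Fin 2) :
    freeGroupToPW p (FreeGroup.of a) = PW.letter (Gp p) a := FreeGroup.lift_apply_of

theorem freeGroupToPW_op (p : ℕ) (w : FreeGroup (Fin 2)) (G : Type) [Group G] (h : (Gp p).Mem G)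
    (φ : Fin 2 → G) : (freeGroupToPW p w).op G h φ = FreeGroup.lift φ w := by
  let ev : PW (Gp p) (Fin 2) →* G :=
    { toFun := fun u => u.op G h φ
      map_one' := PW.one_op G h φ
      map_mul' := fun u v => PW.mul_op u v G h φ }
  have : ev.comp (freeGroupToPW p) = FreeGroup.lift φ := by
    ext a
    simp only [MonoidHom.comp_apply, freeGroupToPW_of, FreeGroup.lift_apply_of]
    rfl
  exact DFunLike.congr_fun this w

/-- Free groups embed, being residually finite `p`-groups. -/
theorem injective_freeGroupToPW {p : ℕ} (hp : p.Prime) : Function.Injective (freeGroupToPW p) := by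
  rw [injective_iff_map_eq_one]
  intro w hw
  by_contra hne
  obtain ⟨G, _, hf, hG, φ, hφ⟩ := exists_isPGroup_lift_ne_one hp hne
  apply hφ
  have h : (Gp p).Mem G := mem_Gp.2 ⟨hf, hG⟩
  rw [← freeGroupToPW_op p w G h φ, hw, PW.one_op]

theorem inOmega_freeGroupToPW (p : ℕ) (w : FreeGroup (Fin 2)) :
    InOmega sigma (Gp p) (Fin 2) (freeGroupToPW p w) := by
  have hl : ∀ a, InOmega sigma (Gp p) (Fin 2) (freeGroupToPW p (FreeGroup.of a)) := fun a => by
    rw [freeGroupToPW_of]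
    exact InOmega.letter a
  induction w using FreeGroup.induction_on with
  | C1 =>
    rw [map_one]
    exact (InOmega.letter 0).omegaInv.mul (InOmega.letter 0)
  | of a => exact hl a
  | inv_of a _ =>
    rw [map_inv]
    exact (hl a).omegaInv
  | mul u v hu hv =>
    rw [map_mul]
    exact hu.mul hv

theorem exists_freeGroupToPW_eq {p : ℕ} (hp : p.Prime) {u : PW (Gp p) (Fin 2)}
    (hu : InOmega sigma (Gp p) (Fin 2) u) : ∃ w, freeGroupToPW p w = u := by
  induction hu with
  | letter a => exact ⟨_, freeGroupToPW_of p a⟩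
  | op n f hf u _ ih =>
    choose w hw using ih
    rcases hf with (hf | hf) | ⟨n, t, j, m, hm, -, hdet, hf⟩
    · cases hf
      exact ⟨w 0 * w 1, by rw [map_mul, hw, hw, PW.mulOp_subst]⟩
    · cases hf
      exact ⟨(w 0)⁻¹, by rw [map_inv, hw, PW.inv_eq_omegaInv, PW.omegaInvOp_subst]⟩
    · cases hf
      rcases sigma_op_Gp hp t j hm hdet with h | h
      · refine ⟨1, ?_⟩
        rw [map_one]
        exact PW.ext_of_isGroupal (isGroupal_Gp p) fun G _ hG φ =>
          (PW.one_op G hG φ).trans (h G hG _).symm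
      · refine ⟨w j, ?_⟩
        rw [hw]
        exact PW.ext_of_isGroupal (isGroupal_Gp p) fun G _ hG φ =>
          (h G hG fun i => (u i).op G hG φ).symm

theorem range_freeGroupToPW {p : ℕ} (hp : p.Prime) :
    Set.range (freeGroupToPW p) = {u | InOmega sigma (Gp p) (Fin 2) u} := by
  ext u
  constructor
  · rintro ⟨w, rfl⟩
    exact inOmega_freeGroupToPW p w
  · exact exists_freeGroupToPW_eq hp

/-! ### The equation has no solution in `σ`-terms -/

theorem isTermSystem_witness : witness.IsTermSystem sigma := by
  have hl : ∀ y : Fin 3 ⊕ Fin 2, InOmega sigma allSemigroups (Fin 3 ⊕ Fin 2) (PW.letter _ y) :=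
    InOmega.letter
  refine ⟨fun _ => ?_, fun _ => (hl _).omegaInv.mul (hl _), InOmega.letter⟩
  have h1 := ((hl (Sum.inl 0)).mul (hl (Sum.inl 0))).mul (hl (Sum.inr 0))
  have h2 := (((hl (Sum.inl 1)).omegaInv.mul ((hl (Sum.inl 2)).mul (hl (Sum.inl 2)))).mul
    (hl (Sum.inr 1))).mul (hl (Sum.inl 1))
  exact ((h1.mul h2).mul h1.omegaInv).mul h2.omegaInv

open scoped commutatorElement

theorem witness_lhs_op (i : Fin witness.numEq) (G : Type) [Group G] (h : allSemigroups.Mem G)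
    (s : Fin 3 ⊕ Fin 2 → G) :
    (witness.lhs i).op G h s = ⁅s (Sum.inl 0) ^ 2 * s (Sum.inr 0),
      (s (Sum.inl 1))⁻¹ * s (Sum.inl 2) ^ 2 * s (Sum.inr 1) * s (Sum.inl 1)⁆ := by
  simp only [witness, commPW, PW.mul_op, PW.omegaInv_op, PW.letter, commutatorElement_def, pow_two]

theorem witness_rhs_op (i : Fin witness.numEq) (G : Type) [Group G] (h : allSemigroups.Mem G)
    (s : Fin 3 ⊕ Fin 2 → G) : (witness.rhs i).op G h s = 1 := by
  simp only [witness, PW.mul_op, PW.omegaInv_op, inv_mul_cancel]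

/-- A solution of the equation modulo `𝖦_p` in `σ`-terms would be a solution in the free group. -/
theorem not_exists_sigma_solution {p : ℕ} (hp : p.Prime) :
    ¬ ∃ δ, witness.IsSolution (Gp p) δ ∧ ∀ y, InOmega sigma allSemigroups (Fin 2) (δ y) := by
  rintro ⟨δ, hδ, hσ⟩
  choose w hw using fun y : Fin 3 ⊕ Fin 2 => exists_freeGroupToPW_eq hp ((hσ y).psi (Gp p))
  have hparam : ∀ a : Fin 2, w (Sum.inr a) = FreeGroup.of a := by
    intro a
    apply injective_freeGroupToPW hp
    rw [hw, freeGroupToPW_of]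
    exact congrArg (PW.psi (Gp p)) (hδ.param a)
  refine not_exists_freeGroup_solution
    ⟨w (Sum.inl 0), w (Sum.inl 1), w (Sum.inl 2), injective_freeGroupToPW hp ?_⟩
  refine PW.ext_of_isGroupal (isGroupal_Gp p) fun G _ hG φ => ?_
  have hval : ∀ y : Fin 3 ⊕ Fin 2,
      FreeGroup.lift φ (w y) = (δ y).op G ((Gp p).mem_all hG) φ := fun y => by
    rw [← freeGroupToPW_op p _ G hG, hw]
    rfl
  have heq : ((witness.lhs (0 : Fin 1)).subst δ).op G ((Gp p).mem_all hG) φ =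
      ((witness.rhs (0 : Fin 1)).subst δ).op G ((Gp p).mem_all hG) φ :=
    congrArg (fun u : PW (Gp p) (Fin 2) => u.op G hG φ) (hδ.eqn (0 : Fin 1))
  have h1 := (witness_lhs_op (0 : Fin 1) G ((Gp p).mem_all hG)
    (fun y => (δ y).op G ((Gp p).mem_all hG) φ)).symm.trans
      (heq.trans (witness_rhs_op (0 : Fin 1) G ((Gp p).mem_all hG) _))
  simp only [← hval] at h1
  rw [freeGroupToPW_op, map_one, PW.one_op, ← hparam 0, ← hparam 1, map_commutatorElement]
  simpa only [map_mul, map_pow, map_inv] using h1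

/-! ### The solution `x = a ^ (-1/2)` modulo groups of odd order -/

/-- Exponents tending to `-1/2` modulo each odd number: `2 * halfExp k + 1 = 2 ^ k! * (k! - 1) + 1`.
-/
def halfExp (k : ℕ) : ℕ := 2 ^ (k.factorial - 1) * (k.factorial - 1)

theorem le_halfExp (k : ℕ) : k.factorial - 1 ≤ halfExp k :=
  Nat.le_mul_of_pos_left _ (by positivity)

theorem tendsto_factorial_sub_one :
    Filter.Tendsto (fun k => Nat.factorial k - 1) Filter.atTop Filter.atTop :=
  (Filter.tendsto_sub_atTop_nat 1).comp tendsto_factorial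

theorem factorial_sub_one_eventually_eq (p : ℕ) (hp : 0 < p) :
    ∀ᶠ k in Filter.atTop, ((Nat.factorial k - 1 : ℕ) : ZMod p) = -1 := by
  filter_upwards [factorial_eventually_zero p hp] with k hk
  rw [Nat.cast_sub (Nat.factorial_pos k), hk]
  simp

theorem tendsto_halfExp : Filter.Tendsto halfExp Filter.atTop Filter.atTop :=
  Filter.tendsto_atTop_mono le_halfExp tendsto_factorial_sub_one

theorem converges_spow_halfExp {V : Pseudovariety} {A : Type} (u : PW V A) :
    PW.Converges (fun k => spow u (halfExp k)) := by
  intro T _ h φ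
  have := V.finite h
  simp only [PW.spow_op]
  refine spow_eventually_const _ _ tendsto_halfExp fun p hp => ?_
  have : NeZero p := ⟨hp.ne'⟩
  obtain ⟨c, hc⟩ := pow_eventually_const (2 : ZMod p) _ tendsto_factorial_sub_one
    (fun q hq => ⟨-1, factorial_sub_one_eventually_eq q hq⟩)
  refine ⟨c * -1, ?_⟩
  filter_upwards [hc, factorial_sub_one_eventually_eq p hp] with k hk hk'
  rw [halfExp, Nat.cast_mul, hk', Nat.cast_pow, Nat.cast_ofNat, hk]

theorem sq_lim_halfExp_mul_self {V : Pseudovariety} {A : Type} (u : PW V A) (G : Type) [Group G]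
    (h : V.Mem G) (hodd : Odd (Nat.card G)) (φ : A → G) :
    (PW.lim _ (converges_spow_halfExp u)).op G h φ ^ 2 * u.op G h φ = 1 := by
  have := V.finite h
  set n := Nat.card G with hn
  have hn0 : 0 < n := Nat.card_pos
  obtain ⟨k, hk, hk1, hk2, hk3⟩ := ((PW.lim_op _ (converges_spow_halfExp u) G h φ).and
    ((factorial_sub_one_eventually_eq n hn0).and
      ((tendsto_halfExp.eventually_ge_atTop 1).and
        (Filter.eventually_ge_atTop n.totient)))).exists
  rw [← hk, PW.spow_op, spow_eq_pow _ hk2, ← pow_mul, ← pow_succ]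
  have htwo : ((2 : ZMod n)) ^ k.factorial = 1 := by
    obtain ⟨c, hc⟩ := Nat.dvd_factorial (Nat.totient_pos.2 hn0) hk3
    have h1 := Nat.ModEq.pow_totient ((Nat.coprime_two_left).2 hodd)
    have h2 := (ZMod.natCast_eq_natCast_iff _ _ _).2 h1
    rw [Nat.cast_pow, Nat.cast_ofNat, Nat.cast_one] at h2
    rw [hc, pow_mul, h2, one_pow]
  have hdvd : n ∣ halfExp k * 2 + 1 := by
    rw [← ZMod.natCast_eq_zero_iff, Nat.cast_add, halfExp, mul_right_comm, ← pow_succ,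
      Nat.sub_add_cancel (Nat.factorial_pos k), Nat.cast_mul, hk1, Nat.cast_pow, Nat.cast_ofNat,
      htwo]
    simp
  exact orderOf_dvd_iff_pow_eq_one.1 ((orderOf_dvd_natCard _).trans hdvd)

theorem lift_spow {A : Type} {T : Type*} [Semigroup T] (f : A → T) (s : FreeSemigroup A) (k : ℕ) :
    FreeSemigroup.lift f (spow s k) = spow (FreeSemigroup.lift f s) k := by
  unfold spow
  induction (k - 1) with
  | zero => rfl
  | succ n ih => rw [Function.iterate_succ_apply', Function.iterate_succ_apply', map_mul, ih]

open scoped Computability in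
theorem exists_mem_kstar_lift_eq_spow {A : Type} (a : A) (k : ℕ) :
    ∃ u : FreeSemigroup A, u.head :: u.tail ∈ ({[a]} : Language A)∗ ∧
      FreeSemigroup.lift (PW.letter allSemigroups) u = spow (PW.letter allSemigroups a) k := by
  refine ⟨spow (FreeSemigroup.of a) k, ?_, (lift_spow _ _ _).trans (by rw [FreeSemigroup.lift_of])⟩
  rw [Language.mem_kstar]
  unfold spow
  generalize k - 1 = m
  suffices h : ∃ L : List (List A), ((fun t => t * FreeSemigroup.of a)^[m] (FreeSemigroup.of a)).head
      :: ((fun t => t * FreeSemigroup.of a)^[m] (FreeSemigroup.of a)).tail = L.flatten ∧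
      ∀ y ∈ L, y = [a] from h
  induction m with
  | zero => exact ⟨[[a]], by simp, by simp⟩
  | succ m ih =>
    obtain ⟨L, hL, hL'⟩ := ih
    refine ⟨L ++ [[a]], ?_, ?_⟩
    · rw [Function.iterate_succ_apply', FreeSemigroup.head_mul, FreeSemigroup.tail_mul,
        List.flatten_append, ← hL]
      simp
    · intro y hy
      rcases List.mem_append.1 hy with hy | hy
      · exact hL' y hy
      · simpa using hy

/-- The assignment `x = lim a ^ halfExp k`, `y = a`, `z = b`. -/
noncomputable def halfSolution : Fin 3 ⊕ Fin 2 → PW allSemigroups (Fin 2) :=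
  Sum.elim ![PW.lim _ (converges_spow_halfExp (PW.letter allSemigroups 0)),
    PW.letter allSemigroups 0, PW.letter allSemigroups 1] (PW.letter allSemigroups)

theorem halfSolution_mem_Cl (x : Fin 3) : halfSolution (Sum.inl x) ∈ Cl (witness.L x) := by
  fin_cases x
  · exact mem_closure_of_tendsto (PW.tendsto_lim _ _)
      (Filter.Eventually.of_forall fun k => exists_mem_kstar_lift_eq_spow 0 (halfExp k))
  · exact subset_closure ⟨FreeSemigroup.of 0, trivial, FreeSemigroup.lift_of _ _⟩
  · exact subset_closure (exists_mem_kstar_lift_eq_spow 1 1)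

/-- The value of the left-hand side is `1` in groups of odd order, as `x²a` has value `1`. -/
theorem lhs_halfSolution_op_of_odd (i : Fin witness.numEq) (G : Type) [Group G]
    (h : allSemigroups.Mem G) (hodd : Odd (Nat.card G)) (φ : Fin 2 → G) :
    ((witness.lhs i).subst halfSolution).op G h φ = 1 := by
  refine (witness_lhs_op i G h (fun y => (halfSolution y).op G h φ)).trans ?_
  have h1 : (halfSolution (Sum.inl 0)).op G h φ ^ 2 * (halfSolution (Sum.inr 0)).op G h φ = 1 :=
    sq_lim_halfExp_mul_self (PW.letter allSemigroups 0) G h hodd φ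
  rw [h1, commutatorElement_one_left]

theorem isSolution_halfSolution {p : ℕ} (hp : p.Prime) (hp2 : p ≠ 2) :
    witness.IsSolution (Gp p) halfSolution := by
  refine ⟨halfSolution_mem_Cl, fun _ => rfl, fun i => ?_⟩
  refine PW.ext_of_isGroupal (isGroupal_Gp p) fun G _ hG φ => ?_
  obtain ⟨hf, hpG⟩ := mem_Gp.1 hG
  have : Fact p.Prime := ⟨hp⟩
  have hodd : Odd (Nat.card G) := by
    obtain ⟨n, hn⟩ := IsPGroup.iff_card.1 hpG
    rw [hn]
    exact (hp.odd_of_ne_two hp2).pow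
  exact (lhs_halfSolution_op_of_odd i G ((Gp p).mem_all hG) hodd φ).trans
    (witness_rhs_op i G _ _).symm

/-! ### Finite nilpotent groups -/

/-- The system with the equation `[x²a, y⁻¹z²by] ^ (2 ^ ω) = 1`. The power is `1` modulo `𝖦_2` and
does not change the equation modulo `𝖦_p` for odd `p`. -/
noncomputable def witnessNil : EqSystem (Fin 2) :=
  { witness with lhs := fun i => (witness.lhs i).powOmega 2 two_pos }

theorem isTermSystem_witnessNil : witnessNil.IsTermSystem sigma :=
  ⟨fun i => (isTermSystem_witness.lhs i).powOmega 2 two_pos, isTermSystem_witness.rhs,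
    isTermSystem_witness.param⟩

/-- In a finite nilpotent group the left-hand side of the original equation lies in the normal Sylow
`2`-subgroup, since the quotient has odd order; hence its `2 ^ ω`-th power is `1`. -/
theorem isSolution_witnessNil : witnessNil.IsSolution Gnil halfSolution := by
  refine ⟨halfSolution_mem_Cl, fun _ => rfl, fun i => ?_⟩
  refine PW.ext_of_isGroupal isGroupal_Gnil fun G _ hG φ => ?_
  obtain ⟨hf, hnil⟩ := mem_Gnil.1 hG
  have hall := Gnil.mem_all hG
  refine Eq.trans ?_ (witness_rhs_op i G hall _).symm
  obtain ⟨S⟩ : Nonempty (Sylow 2 G) := inferInstance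
  let π : G →* G ⧸ (S : Subgroup G) := QuotientGroup.mk' _
  have hQ : allSemigroups.Mem (G ⧸ (S : Subgroup G)) :=
    allSemigroups.of_surjective (π : G →ₙ* G ⧸ (S : Subgroup G))
      (QuotientGroup.mk'_surjective _) hall
  have hodd : Odd (Nat.card (G ⧸ (S : Subgroup G))) := by
    rw [← Nat.not_even_iff_odd, even_iff_two_dvd]
    exact S.not_dvd_index
  have hmem : ((witness.lhs i).subst halfSolution).op G hall φ ∈ (S : Subgroup G) := by
    rw [← QuotientGroup.eq_one_iff]
    exact (((witness.lhs i).subst halfSolution).natural hall hQ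
      (π : G →ₙ* G ⧸ (S : Subgroup G)) φ).trans (lhs_halfSolution_op_of_odd i _ hQ hodd _)
  refine PW.powOmega_op_eq_one (p := 2) two_pos dvd_rfl (witness.lhs i) G hall
    (fun y => (halfSolution y).op G hall φ) ?_
  obtain ⟨l, hl⟩ := S.isPGroup' ⟨_, hmem⟩
  exact ⟨l, congrArg Subtype.val hl⟩

theorem isSolution_Gp_of_witnessNil {p : ℕ} (hp : p.Prime) (hp2 : p ≠ 2)
    {δ : Fin 3 ⊕ Fin 2 → PW allSemigroups (Fin 2)} (hδ : witnessNil.IsSolution Gnil δ) :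
    witness.IsSolution (Gp p) δ := by
  refine ⟨hδ.constraint, hδ.param, fun i => ?_⟩
  refine PW.ext_of_isGroupal (isGroupal_Gp p) fun G _ hG φ => ?_
  obtain ⟨hf, hpG⟩ := mem_Gp.1 hG
  have hall := (Gp p).mem_all hG
  have h1 : ((witnessNil.lhs i).subst δ).op G hall φ = ((witness.rhs i).subst δ).op G hall φ :=
    congrArg (fun u : PW Gnil (Fin 2) => u.op G (Gp_mem_Gnil hp hG) φ) (hδ.eqn i)
  refine Eq.trans ?_ h1
  refine (PW.powOmega_op_eq_self hp two_pos ?_ (witness.lhs i) G hpG hall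
    (fun y => (δ y).op G hall φ)).symm
  rwa [Nat.prime_dvd_prime_iff_eq hp Nat.prime_two]

theorem not_completelyReducible_Gnil : ¬ CompletelyReducible sigma Gnil := by
  intro h
  obtain ⟨δ, hδ, hσ⟩ :=
    h (Fin 2) witnessNil isTermSystem_witnessNil ⟨halfSolution, isSolution_witnessNil⟩
  exact not_exists_sigma_solution Nat.prime_three
    ⟨δ, isSolution_Gp_of_witnessNil Nat.prime_three (by norm_num) hδ, hσ⟩

end Pseudo

open scoped commutatorElement
theorem mainTheorem4 :
    ¬ Pseudo.CompletelyReducible Pseudo.sigma Pseudo.Gnil ∧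
    Pseudo.witness.IsTermSystem Pseudo.sigma ∧
    (∀ p : ℕ, p.Prime → p ≠ 2 →
      (∃ δ, Pseudo.witness.IsSolution (Pseudo.Gp p) δ) ∧
      ¬ Pseudo.witness.Reducible Pseudo.sigma (Pseudo.Gp p)) ∧
    (¬ ∃ x y z : FreeGroup (Fin 2),
      ⁅x ^ 2 * FreeGroup.of 0, y⁻¹ * z ^ 2 * FreeGroup.of 1 * y⁆ = 1) ∧
    (∀ p : ℕ, p.Prime →
      ∃ e : FreeGroup (Fin 2) →ₙ* Pseudo.PW (Pseudo.Gp p) (Fin 2),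
        Function.Injective e ∧
        (∀ a, e (FreeGroup.of a) = Pseudo.PW.letter (Pseudo.Gp p) a) ∧
        Set.range e = {u | Pseudo.InOmega Pseudo.sigma (Pseudo.Gp p) (Fin 2) u}) := by
  refine ⟨Pseudo.not_completelyReducible_Gnil, Pseudo.isTermSystem_witness, fun p hp hp2 => ?_,
    Pseudo.not_exists_freeGroup_solution, fun p hp => ?_⟩
  · have hsol := Pseudo.isSolution_halfSolution hp hp2
    exact ⟨⟨_, hsol⟩, fun h => Pseudo.not_exists_sigma_solution hp (h ⟨_, hsol⟩)⟩
  · let := Pseudo.PW.groupGp p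
    exact ⟨(Pseudo.freeGroupToPW p).toMulHom,
      Pseudo.injective_freeGroupToPW hp, Pseudo.freeGroupToPW_of p, Pseudo.range_freeGroupToPW hp⟩
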